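/- Let $\mathcal H$ be a real Hilbert space and let $f:\mathcal H\to\,]-\infty,+\infty]$ be proper, convex and lower semicontinuous, with $\operatorname{int}\operatorname{dom} f\neq\varnothing$, and Gâteaux differentiable on $\operatorname{int}\operatorname{dom} f$. The Bregman distance is $D_f(x,y)=f(x)-f(y)-\langle\nabla f(y),x-y\rangle$ if $y\in\operatorname{int}\operatorname{dom} f$, and $D_f(x,y)=+\infty$ otherwise. For a nonempty set $C\subseteq\mathcal H$, the backward Bregman projection of $y\in\operatorname{int}\operatorname{dom}f$ and the forward Bregman projection of $x\in\operatorname{dom} f$ onto $C$ are the sets $$\overleftarrow{P}^f_C(y)=\{u\in C\cap\operatorname{dom} f:\ D_f(u,y)\le D_f(c,y)\ \ \forall c\in C\},$$ $$\overrightarrow{P}^f_C(x)=\{v\in C\cap\operatorname{int}\operatorname{dom} f:\ D_f(x,v)\le D_f(x,c)\ \ \forall c\in C\}.$$ Let $S=\{q_0,q_1,\dots,q_m\}\subseteq\operatorname{int}\operatorname{dom} f$, and put $$\overleftarrow{E}_f(S)=\{x\in\operatorname{dom} f:\ D_f(x,q_0)=D_f(x,q_1)=\dots=D_f(x,q_m)\},\qquad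 L=\operatorname{span}\{\nabla f(q_i)-\nabla f(q_0):1\le i\le m\}.$$ The set of backward Bregman circumcenters of $S$ is $\overleftarrow{CC}_f(S)=\operatorname{aff}(S)\cap\overleftarrow{E}_f(S)$. Assume $\overleftarrow{E}_f(S)\ne\varnothing$ and let $z\in\overleftarrow{E}_f(S)$. Then the following hold. (i) $\overleftarrow{CC}_f(S)=\operatorname{aff}(S)\cap\operatorname{dom} f\cap(z+L^\perp)$. (ii) Suppose that $\mathcal H$ is finite-dimensional ($\mathcal H=\mathbb R^n$) and that $f$ is Legendre, that is, essentially smooth ($\operatorname{dom}\partial f=\operatorname{int}\operatorname{dom}f\ne\varnothing$, $f$ is Gâteaux differentiable there, and $\|\nabla f(x_k)\|\to+\infty$ for every sequence $(x_k)$ in $\operatorname{int}\operatorname{dom}f$ converging to a boundary point of $\operatorname{dom}f$) and essentially strictly convex ($(\partial f)^{-1}$ is locally bounded on its domain, and $f$ is strictly convex on every convex subset of $\operatorname{dom}\partial f$). Suppose that the domain of the conjugate $f^*$ is open. Suppose that $f$ allows forward Bregman projections, that is, $\nabla^2 f$ exists and is continuous on $\operatorname{int}\operatorname{dom} f$, $D_f$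 is convex on $(\operatorname{int}\operatorname{dom} f)^2$, and $D_f(x,\cdot)$ is strictly convex on $\operatorname{int}\operatorname{dom} f$ for every $x\in\operatorname{int}\operatorname{dom} f$. Suppose finally that $\operatorname{aff}(S)\subseteq\operatorname{int}\operatorname{dom} f$. Write $V=\nabla f(\operatorname{aff}(S))$. (a) If $z\in\operatorname{int}\operatorname{dom} f$ (so that $\nabla f(z)$ is defined), if $V$ is closed and convex, and if $$\pm\bigl(\nabla f(q_i)-\nabla f(q_0)\bigr)\in V-\overleftarrow{P}^{f^*}_V(\nabla f(z))\qquad\text{for all } i\in\{1,\dots,m\},\tag{$*$}$$ then $\overrightarrow{P}^f_{\operatorname{aff}(S)}(z)$ consists of exactly one point, and this point belongs to $\overleftarrow{CC}_f(S)$. (b) If $V$ is a closed affine subspace, then $(*)$ holds whenever $z\in\operatorname{int}\operatorname{dom} f$; and, for every $z\in\overleftarrow{E}_f(S)$ (whether or not $z\in\operatorname{int}\operatorname{dom}f$), $\overrightarrow{P}^f_{\operatorname{aff}(S)}(z)$ consists of exactly one point, and this point belongs to $\overleftarrow{CC}_f(S)$. -/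

import Mathlib

open scoped Pointwise

noncomputable section

namespace BregmanCC

variable {H : Type*} [NormedAddCommGroup H] [InnerProductSpace ℝ H]

/-- The effective domain of an extended-real-valued function. -/
def edom (f : H → EReal) : Set H := {x | f x < ⊤}

/-- The set of proper closed (lower semicontinuous) convex functions
from `H` to `]-∞, +∞]`; convexity is convexity of the epigraph. -/
structure IsGammaZero (f : H → EReal) : Prop where
  ne_bot : ∀ x, f x ≠ ⊥
  nonempty_edom : (edom f).Nonempty
  convex_epigraph : Convex ℝ {p : H × ℝ | f p.1 ≤ (p.2 : EReal)}
  lowerSemicontinuous : LowerSemicontinuous f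

/-- The Fenchel conjugate `f*(u) = sup_x (⟨u, x⟩ - f x)`. -/
def conj (f : H → EReal) : H → EReal :=
  fun u => ⨆ x : H, ((inner ℝ u x : ℝ) : EReal) - f x

/-- The subdifferential `∂f(x)`. -/
def subdiff (f : H → EReal) (x : H) : Set H :=
  {u | ∀ y, f x + ((inner ℝ u (y - x) : ℝ) : EReal) ≤ f y}

/-- The domain of the set-valued operator `∂f`. -/
def domSubdiff (f : H → EReal) : Set H := {x | (subdiff f x).Nonempty}

/-- `g` is the Gâteaux gradient of `f` at the point `x` of `int dom f`: the derivative of `f`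
at `x` along every direction `h` exists and equals `⟨g, h⟩`. -/
def HasGateauxGrad (f : H → EReal) (g x : H) : Prop :=
  x ∈ interior (edom f) ∧ ∀ h, HasLineDerivAt ℝ (fun y => (f y).toReal) (inner ℝ g h) x h

/-- `f` is Gâteaux differentiable at `x`. -/
def GateauxDiffAt (f : H → EReal) (x : H) : Prop := ∃ g, HasGateauxGrad f g x

open Classical in
/-- The Gâteaux gradient `∇f(x)` (with the value `0` where `f` is not Gâteaux differentiable). -/
def grad (f : H → EReal) (x : H) : H :=
  if h : GateauxDiffAt f x then h.choose else 0

/-- Local boundedness of a set-valued operator at a point. -/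
def LocallyBoundedAt (A : H → Set H) (x : H) : Prop :=
  ∃ δ > 0, Bornology.IsBounded (⋃ y ∈ Metric.closedBall x δ, A y)

structure EssentiallySmooth (f : H → EReal) : Prop where
  domSubdiff_eq : domSubdiff f = interior (edom f)
  nonempty_interior : (interior (edom f)).Nonempty
  gateauxDiffAt : ∀ x ∈ interior (edom f), GateauxDiffAt f x
  norm_grad_tendsto : ∀ (u : ℕ → H) (x : H), (∀ k, u k ∈ interior (edom f)) →
    x ∈ frontier (edom f) → Filter.Tendsto u Filter.atTop (nhds x) →
    Filter.Tendsto (fun k => ‖grad f (u k)‖) Filter.atTop Filter.atTop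

structure EssentiallyStrictlyConvex (f : H → EReal) : Prop where
  locallyBounded_inverse : ∀ u : H, {x | u ∈ subdiff f x}.Nonempty →
    LocallyBoundedAt (fun v => {x | v ∈ subdiff f x}) u
  strictConvexOn : ∀ C ⊆ domSubdiff f, Convex ℝ C →
    StrictConvexOn ℝ C (fun x => (f x).toReal)

/-- Legendre functions. -/
structure IsLegendre (f : H → EReal) : Prop where
  isGammaZero : IsGammaZero f
  essentiallySmooth : EssentiallySmooth f
  essentiallyStrictlyConvex : EssentiallyStrictlyConvex f

open Classical in
/-- The Bregman distance `D_f(x, y)`. -/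
def bregman (f : H → EReal) (x y : H) : EReal :=
  if y ∈ interior (edom f) then
    f x - f y - ((inner ℝ (grad f y) (x - y) : ℝ) : EReal)
  else ⊤

/-- The backward Bregman projection of `y` onto `C`, as a set. -/
def backProj (f : H → EReal) (C : Set H) (y : H) : Set H :=
  {u | u ∈ C ∩ edom f ∧ ∀ c ∈ C, bregman f u y ≤ bregman f c y}

/-- The forward Bregman projection of `x` onto `C`, as a set. -/
def forwardProj (f : H → EReal) (C : Set H) (x : H) : Set H :=
  {v | v ∈ C ∩ interior (edom f) ∧ ∀ c ∈ C, bregman f x v ≤ bregman f x c}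

/-- The function `f` (which is meant to be Legendre with `dom f*` open) allows forward Bregman
projections. The Bregman distance is finite on `(int dom f)²`, so the convexity conditions are
stated for its real values. -/
structure AllowsForwardProj (f : H → EReal) : Prop where
  hessian : ∃ hess : H → H →L[ℝ] H, ContinuousOn hess (interior (edom f)) ∧
    ∀ x ∈ interior (edom f), HasFDerivAt (grad f) (hess x) x
  convexOn : ConvexOn ℝ (interior (edom f) ×ˢ interior (edom f))
    (fun p : H × H => (bregman f p.1 p.2).toReal)
  strictConvexOn : ∀ x ∈ interior (edom f),
    StrictConvexOn ℝ (interior (edom f)) (fun y => (bregman f x y).toReal)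

/-- The backward equidistant set of `K`: the points `p` of `dom f` for which `D_f(p, y)` has the
same value for all `y ∈ K`. -/
def backEquidist (f : H → EReal) (K : Set H) : Set H :=
  {p | p ∈ edom f ∧ ∀ y ∈ K, ∀ y' ∈ K, bregman f p y = bregman f p y'}

/-- The set of backward Bregman circumcenters of `K`. -/
def backCC (f : H → EReal) (K : Set H) : Set H :=
  (affineSpan ℝ K : Set H) ∩ backEquidist f K

/-- `L = span {∇f(q₁) - ∇f(q₀), …, ∇f(qₘ) - ∇f(q₀)}`. -/
def gradSpan (f : H → EReal) {m : ℕ} (q : Fin (m + 1) → H) : Submodule ℝ H :=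
  Submodule.span ℝ (Set.range fun i : Fin m => grad f (q i.succ) - grad f (q 0))

/-- The image `∇f(aff S)` of the affine hull of `S`. -/
def gradAff (f : H → EReal) (S : Set H) : Set H := grad f '' (affineSpan ℝ S : Set H)

/-- The compatibility condition: for all `i = 1, …, m`, both `∇f(qᵢ) - ∇f(q₀)` and its negative
belong to `V - P`, where `V = ∇f(aff S)` and `P` is the backward Bregman projection with respect
to `f*` of `∇f(z)` onto `V`. -/
def Compatible (f : H → EReal) {m : ℕ} (q : Fin (m + 1) → H) (z : H) : Prop :=
  ∀ i : Fin m,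
    grad f (q i.succ) - grad f (q 0) ∈ gradAff f (Set.range q) -
      backProj (conj f) (gradAff f (Set.range q)) (grad f z) ∧
    -(grad f (q i.succ) - grad f (q 0)) ∈ gradAff f (Set.range q) -
      backProj (conj f) (gradAff f (Set.range q)) (grad f z)

end BregmanCC

end

/-!
Write `D` for `realBregman f`, `M` for the affine hull of the `qᵢ` and `V = ∇f(M)`.

Equating the distances `D(x, qᵢ)` cancels `f x` and leaves linear equations in `x` with normals
`∇f(qᵢ) - ∇f(q₀)`; this is the description of the circumcenters as a slice by `z + Lᗮ`
(`mem_backEquidist_iff`).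

Forward projections are controlled by the identity
`D(z, c) - D(z, p) = D(p, c) + ⟪∇f c - ∇f p, p - z⟫` (`realBregman_sub_realBregman`): since
`D(p, c) > 0` for `c ≠ p`, a point `p` of `M` with `⟪w - ∇f p, p - z⟫ ≥ 0` for all `w ∈ V` is the
unique forward projection of `z` (`forwardProj_eq_singleton`). If moreover `p - z` is orthogonal
to every `∇f(qᵢ) - ∇f(q₀)`, then `p` is a circumcenter. It remains to produce such a `p`.

* If `V` is convex, the conjugate turns `D(z, ·)` on `M` into the function
  `f* - ⟪z, ·⟫` on `V`, up to a constant, and `f*` is differentiable at `∇f p` with gradient `p`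
  (`hasFDerivAt_conj`), because `D(·, p)` grows at least linearly away from `p`. Hence a forward
  projection satisfies the variational inequality (`inner_nonneg_of_mem_forwardProj`), and
  testing it in the directions `±(∇f(qᵢ) - ∇f(q₀))`, which compatibility allows, gives the
  orthogonality.
* If `V` is affine, strict monotonicity of `∇f` shows that no nonzero direction of `V` is
  orthogonal to the direction of `M`; so `M` meets `z + Wᗮ`, with `W` the direction of `V`
  (`exists_mem_inner_eq_zero`). A point `p` of the intersection makes the inner products above
  vanish. This does not ask `z` to lie in the interior of the domain.
-/

noncomputable section

namespace BregmanCC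

variable {H : Type*} [NormedAddCommGroup H] [InnerProductSpace ℝ H] {f : H → EReal}

/-! ### Convexity and the real-valued Bregman distance -/

/-- The real number `f x - f y - ⟪∇f y, x - y⟫`, computed from the real values of `f`. It is the
Bregman distance `bregman f x y` when `x ∈ dom f` and `y ∈ int dom f`. -/
def realBregman (f : H → EReal) (x y : H) : ℝ :=
  (f x).toReal - (f y).toReal - inner ℝ (grad f y) (x - y)

lemma IsGammaZero.coe_toReal (hf : IsGammaZero f) {x : H} (hx : x ∈ edom f) :
    (((f x).toReal : ℝ) : EReal) = f x :=
  EReal.coe_toReal (ne_of_lt hx) (hf.ne_bot x)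

lemma bregman_eq_coe {x y : H} {a b : ℝ} (hx : f x = a) (hy : f y = b)
    (hyi : y ∈ interior (edom f)) :
    bregman f x y = ((a - b - inner ℝ (grad f y) (x - y) : ℝ) : EReal) := by
  rw [bregman, if_pos hyi, hx, hy]
  norm_cast

lemma IsGammaZero.bregman_eq (hf : IsGammaZero f) {x y : H} (hx : x ∈ edom f)
    (hy : y ∈ interior (edom f)) : bregman f x y = (realBregman f x y : EReal) :=
  bregman_eq_coe (hf.coe_toReal hx).symm (hf.coe_toReal (interior_subset hy)).symm hy

lemma IsGammaZero.convexOn_toReal (hf : IsGammaZero f) :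
    ConvexOn ℝ (edom f) fun x => (f x).toReal := by
  have key : ∀ ⦃x⦄, x ∈ edom f → ∀ ⦃y⦄, y ∈ edom f → ∀ ⦃a b : ℝ⦄, 0 ≤ a → 0 ≤ b → a + b = 1 →
      f (a • x + b • y) ≤ ((a * (f x).toReal + b * (f y).toReal : ℝ) : EReal) := by
    intro x hx y hy a b ha hb hab
    exact hf.convex_epigraph (x := (x, (f x).toReal)) (y := (y, (f y).toReal))
      (hf.coe_toReal hx).ge (hf.coe_toReal hy).ge ha hb hab
  have hmem : ∀ ⦃x⦄, x ∈ edom f → ∀ ⦃y⦄, y ∈ edom f → ∀ ⦃a b : ℝ⦄, 0 ≤ a → 0 ≤ b → a + b = 1 →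
      a • x + b • y ∈ edom f := fun x hx y hy a b ha hb hab =>
    (key hx hy ha hb hab).trans_lt (EReal.coe_lt_top _)
  refine ⟨fun x hx y hy a b ha hb hab => hmem hx hy ha hb hab, ?_⟩
  intro x hx y hy a b ha hb hab
  have h := key hx hy ha hb hab
  rw [← hf.coe_toReal (hmem hx hy ha hb hab)] at h
  exact EReal.coe_le_coe_iff.1 h

lemma hasGateauxGrad_grad {x : H} (h : GateauxDiffAt f x) : HasGateauxGrad f (grad f x) x := by
  rw [grad, dif_pos h]
  exact h.choose_spec

lemma HasGateauxGrad.grad_eq {g x : H} (h : HasGateauxGrad f g x) : grad f x = g :=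
  ext_inner_right ℝ fun v => ((hasGateauxGrad_grad ⟨g, h⟩).2 v).unique (h.2 v)

/-- The gradient inequality of convex analysis. -/
lemma IsGammaZero.realBregman_nonneg (hf : IsGammaZero f) {x y : H} (hx : x ∈ edom f)
    (hy : GateauxDiffAt f y) : 0 ≤ realBregman f x y := by
  have hg := hasGateauxGrad_grad hy
  have hyd : y ∈ edom f := interior_subset hg.1
  have hlim := (hg.2 (x - y)).tendsto_slope_zero_right
  have hle : inner ℝ (grad f y) (x - y) ≤ (f x).toReal - (f y).toReal := by
    refine le_of_tendsto hlim ?_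
    filter_upwards [Ioo_mem_nhdsGT (zero_lt_one' ℝ)] with t ht
    have h := hf.convexOn_toReal.2 hyd hx (sub_nonneg.2 ht.2.le) ht.1.le (by ring)
    have e : (1 - t) • y + t • x = y + t • (x - y) := by module
    simp only [e, smul_eq_mul] at h ⊢
    rw [inv_mul_le_iff₀ ht.1]
    linarith
  unfold realBregman
  linarith

lemma IsGammaZero.realBregman_pos (hf : IsGammaZero f)
    (hs : StrictConvexOn ℝ (interior (edom f)) fun x => (f x).toReal) {x y : H}
    (hx : x ∈ interior (edom f)) (hy : GateauxDiffAt f y) (hxy : x ≠ y) :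
    0 < realBregman f x y := by
  have hyi : y ∈ interior (edom f) := (hasGateauxGrad_grad hy).1
  have h2 : (0 : ℝ) < 2⁻¹ := by norm_num
  -- strict convexity at the midpoint, compared with the gradient inequality there
  have hm := hs.2 hx hyi hxy h2 h2 (by norm_num)
  have hmi : (2⁻¹ : ℝ) • x + (2⁻¹ : ℝ) • y ∈ edom f :=
    interior_subset (hs.1 hx hyi h2.le h2.le (by norm_num))
  have h := hf.realBregman_nonneg hmi hy
  have e : (2⁻¹ : ℝ) • x + (2⁻¹ : ℝ) • y - y = (2⁻¹ : ℝ) • (x - y) := by module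
  simp only [realBregman, e, inner_smul_right, smul_eq_mul] at h hm ⊢
  linarith

lemma IsGammaZero.realBregman_le_smul (hf : IsGammaZero f) {x y : H} (hx : x ∈ edom f)
    (hy : y ∈ edom f) {s : ℝ} (hs0 : 0 ≤ s) (hs1 : s ≤ 1) :
    realBregman f (y + s • (x - y)) y ≤ s * realBregman f x y := by
  have h := hf.convexOn_toReal.2 hy hx (sub_nonneg.2 hs1) hs0 (by ring)
  have e : (1 - s) • y + s • x = y + s • (x - y) := by module
  simp only [e, smul_eq_mul] at h
  simp only [realBregman, add_sub_cancel_left, inner_smul_right]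
  linarith

/-- The difference of two values of `D_f(z, ·)` in terms of `D_f(p, c)`. -/
lemma realBregman_sub_realBregman (f : H → EReal) (z c p : H) :
    realBregman f z c - realBregman f z p =
      realBregman f p c + inner ℝ (grad f c - grad f p) (p - z) := by
  simp only [realBregman, inner_sub_left, inner_sub_right]
  ring

/-- On `int dom f` the gradient of a strictly convex function is strictly monotone. -/
lemma IsGammaZero.eq_of_inner_grad_sub_eq_zero (hf : IsGammaZero f)
    (hs : StrictConvexOn ℝ (interior (edom f)) fun x => (f x).toReal) {x y : H}
    (hx : GateauxDiffAt f x) (hy : GateauxDiffAt f y)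
    (h : inner ℝ (grad f x - grad f y) (x - y) = 0) : x = y := by
  by_contra hne
  have h1 := hf.realBregman_pos hs (hasGateauxGrad_grad hx).1 hy hne
  have h2 := hf.realBregman_nonneg (interior_subset (hasGateauxGrad_grad hy).1) hx
  have e : realBregman f x y + realBregman f y x =
      inner ℝ (grad f x - grad f y) (x - y) := by
    simp only [realBregman, inner_sub_left, inner_sub_right]
    ring
  linarith

/-! ### Equidistant points -/

lemma mem_orthogonal_gradSpan_iff {m : ℕ} {q : Fin (m + 1) → H} {x : H} :
    x ∈ (gradSpan f q)ᗮ ↔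
      ∀ i : Fin m, inner ℝ (grad f (q i.succ) - grad f (q 0)) x = 0 := by
  rw [Submodule.mem_orthogonal]
  constructor
  · exact fun h i => h _ (Submodule.subset_span ⟨i, rfl⟩)
  · intro h u hu
    induction hu using Submodule.span_induction with
    | mem u hu => obtain ⟨i, rfl⟩ := hu; exact h i
    | zero => simp
    | add u v _ _ h1 h2 => rw [inner_add_left, h1, h2, add_zero]
    | smul a u _ h1 => rw [inner_smul_left, h1, mul_zero]

/-- Equidistance from the `qᵢ` is a system of linear equations with normals
`∇f(qᵢ) - ∇f(q₀)`, so relative to one solution `z` it is orthogonality to their span. -/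
lemma IsGammaZero.mem_backEquidist_iff (hf : IsGammaZero f) {m : ℕ} {q : Fin (m + 1) → H}
    (hq : ∀ i, q i ∈ interior (edom f)) {z : H} (hz : z ∈ backEquidist f (Set.range q)) {x : H}
    (hx : x ∈ edom f) : x ∈ backEquidist f (Set.range q) ↔ x - z ∈ (gradSpan f q)ᗮ := by
  have hiff : ∀ {p}, p ∈ edom f → (p ∈ backEquidist f (Set.range q) ↔
      ∀ i : Fin m, realBregman f p (q i.succ) = realBregman f p (q 0)) := by
    intro p hp
    constructor
    · intro h i
      have := h.2 (q i.succ) ⟨_, rfl⟩ (q 0) ⟨_, rfl⟩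
      rw [hf.bregman_eq hp (hq _), hf.bregman_eq hp (hq _)] at this
      exact_mod_cast this
    · intro h
      have h0 : ∀ i, realBregman f p (q i) = realBregman f p (q 0) :=
        fun i => Fin.cases rfl h i
      refine ⟨hp, ?_⟩
      rintro _ ⟨i, rfl⟩ _ ⟨j, rfl⟩
      rw [hf.bregman_eq hp (hq _), hf.bregman_eq hp (hq _), h0 i, h0 j]
  rw [hiff hx, mem_orthogonal_gradSpan_iff]
  refine forall_congr' fun i => ?_
  have hzi := (hiff hz.1).1 hz i
  have e : inner ℝ (grad f (q i.succ) - grad f (q 0)) (x - z) =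
      (realBregman f x (q 0) - realBregman f x (q i.succ)) -
        (realBregman f z (q 0) - realBregman f z (q i.succ)) := by
    simp only [realBregman, inner_sub_left, inner_sub_right]
    ring
  rw [e, hzi, sub_self, sub_zero, sub_eq_zero, eq_comm]

/-! ### A sufficient condition for forward projections -/

/-- The variational inequality for the forward projection, read in gradient coordinates, forces
`p` to be the unique forward projection. -/
lemma IsGammaZero.forwardProj_eq_singleton (hf : IsGammaZero f)
    (hs : StrictConvexOn ℝ (interior (edom f)) fun x => (f x).toReal)
    (hdiff : ∀ x ∈ interior (edom f), GateauxDiffAt f x) {M : Set H}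
    (hM : M ⊆ interior (edom f)) {z p : H} (hz : z ∈ edom f) (hp : p ∈ M)
    (h : ∀ c ∈ M, 0 ≤ inner ℝ (grad f c - grad f p) (p - z)) : forwardProj f M z = {p} := by
  have hle : ∀ c ∈ M, realBregman f z p + realBregman f p c ≤ realBregman f z c := by
    intro c hc
    have := realBregman_sub_realBregman f z c p
    linarith [h c hc]
  ext v
  constructor
  · rintro ⟨⟨hv, -⟩, hmin⟩
    by_contra hne
    have h1 := hmin p hp
    rw [hf.bregman_eq hz (hM hv), hf.bregman_eq hz (hM hp), EReal.coe_le_coe_iff] at h1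
    have h2 := hf.realBregman_pos hs (hM hp) (hdiff v (hM hv)) (Ne.symm hne)
    linarith [hle v hv]
  · rintro rfl
    refine ⟨⟨hp, hM hp⟩, fun c hc => ?_⟩
    rw [hf.bregman_eq hz (hM hc), hf.bregman_eq hz (hM hp), EReal.coe_le_coe_iff]
    have := hf.realBregman_nonneg (interior_subset (hM hp)) (hdiff c (hM hc))
    linarith [hle c hc]

/-! ### The conjugate at gradients of the function -/

lemma IsGammaZero.le_conj (hf : IsGammaZero f) {x : H} (hx : x ∈ edom f) (u : H) :
    ((inner ℝ u x - (f x).toReal : ℝ) : EReal) ≤ conj f u := by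
  have h := le_iSup (fun x : H => ((inner ℝ u x : ℝ) : EReal) - f x) x
  rw [EReal.coe_sub, hf.coe_toReal hx]
  exact h

lemma IsGammaZero.conj_le (hf : IsGammaZero f) {u : H} {c : ℝ}
    (h : ∀ x ∈ edom f, inner ℝ u x - (f x).toReal ≤ c) : conj f u ≤ c := by
  refine iSup_le fun x => ?_
  by_cases hx : x ∈ edom f
  · rw [← hf.coe_toReal hx]
    exact_mod_cast h x hx
  · have : f x = ⊤ := not_lt_top_iff.1 hx
    simp [this]

lemma IsGammaZero.conj_grad (hf : IsGammaZero f) {p : H} (hp : GateauxDiffAt f p) :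
    conj f (grad f p) = ((inner ℝ (grad f p) p - (f p).toReal : ℝ) : EReal) := by
  refine le_antisymm (hf.conj_le fun x hx => ?_)
    (hf.le_conj (interior_subset (hasGateauxGrad_grad hp).1) _)
  have := hf.realBregman_nonneg hx hp
  rw [realBregman, inner_sub_right] at this
  linarith

/-- Away from `p`, the distance `D_f(·, p)` grows at least linearly: it has a positive minimum
on a small sphere around `p`, and is convex along rays from `p`. -/
lemma IsGammaZero.exists_mul_norm_le_realBregman [FiniteDimensional ℝ H] (hf : IsGammaZero f)
    (hs : StrictConvexOn ℝ (interior (edom f)) fun x => (f x).toReal) {p : H}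
    (hp : GateauxDiffAt f p) {ε : ℝ} (hε : 0 < ε) :
    ∃ δ > 0, ∀ x ∈ edom f, ε ≤ ‖x - p‖ → δ * ‖x - p‖ ≤ realBregman f x p := by
  have hpi := (hasGateauxGrad_grad hp).1
  obtain ⟨r₀, hr₀, hball⟩ := Metric.nhds_basis_closedBall.mem_iff.1
    (isOpen_interior.mem_nhds hpi)
  set r := min r₀ ε with hrdef
  have hr : 0 < r := lt_min hr₀ hε
  have hsub : Metric.sphere p r ⊆ interior (edom f) := fun x hx =>
    hball (Metric.closedBall_subset_closedBall (min_le_left _ _)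
      (Metric.sphere_subset_closedBall hx))
  have hcont : ContinuousOn (fun x => realBregman f x p) (Metric.sphere p r) := by
    have := hf.convexOn_toReal.continuousOn_interior.mono hsub
    unfold realBregman
    fun_prop
  obtain ⟨d, hd, hdle⟩ : ∃ d > 0, ∀ x ∈ Metric.sphere p r, d ≤ realBregman f x p := by
    rcases (Metric.sphere p r).eq_empty_or_nonempty with he | hne
    · exact ⟨1, one_pos, by simp [he]⟩
    · obtain ⟨x₀, hx₀, hmin⟩ := (isCompact_sphere p r).exists_isMinOn hne hcont
      exact ⟨_, hf.realBregman_pos hs (hsub hx₀) hp (Metric.ne_of_mem_sphere hx₀ hr.ne'),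
        fun x hx => hmin hx⟩
  refine ⟨d / r, by positivity, fun x hx hεx => ?_⟩
  have hn : 0 < ‖x - p‖ := hε.trans_le hεx
  have hrx : r / ‖x - p‖ ≤ 1 := (div_le_one hn).2 ((min_le_right _ _).trans hεx)
  have h1 := hf.realBregman_le_smul hx (interior_subset hpi) (by positivity) hrx
  have h2 := hdle (p + (r / ‖x - p‖) • (x - p)) (by
    rw [mem_sphere_iff_norm, add_sub_cancel_left, norm_smul, Real.norm_of_nonneg (by positivity)]
    field_simp)
  have h3 := h2.trans h1
  calc d / r * ‖x - p‖ ≤ (r / ‖x - p‖ * realBregman f x p) / r * ‖x - p‖ := by gcongr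
    _ = realBregman f x p := by field_simp

/-- First-order expansion of the conjugate at `∇f(p)`, with gradient `p`. -/
lemma IsGammaZero.exists_conj_grad_add_le [FiniteDimensional ℝ H] (hf : IsGammaZero f)
    (hs : StrictConvexOn ℝ (interior (edom f)) fun x => (f x).toReal) {p : H}
    (hp : GateauxDiffAt f p) {ε : ℝ} (hε : 0 < ε) :
    ∃ δ > 0, ∀ k : H, ‖k‖ ≤ δ → conj f (grad f p + k) ≤
      ((inner ℝ (grad f p) p - (f p).toReal + inner ℝ p k + ε * ‖k‖ : ℝ) : EReal) := by
  obtain ⟨δ, hδ, hgrow⟩ := hf.exists_mul_norm_le_realBregman hs hp hε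
  refine ⟨δ, hδ, fun k hk => hf.conj_le fun x hx => ?_⟩
  have hkx : inner ℝ k (x - p) ≤ ‖k‖ * ‖x - p‖ := real_inner_le_norm _ _
  have hmain : inner ℝ k (x - p) - realBregman f x p ≤ ε * ‖k‖ := by
    rcases le_total ε ‖x - p‖ with h | h
    · have h1 := hgrow x hx h
      have h2 : ‖k‖ * ‖x - p‖ ≤ δ * ‖x - p‖ := by gcongr
      have h3 : 0 ≤ ε * ‖k‖ := by positivity
      linarith
    · have h1 := hf.realBregman_nonneg hx hp
      have h2 : ‖k‖ * ‖x - p‖ ≤ ‖k‖ * ε := by gcongr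
      linarith
  simp only [realBregman, inner_sub_right, inner_add_left] at hmain ⊢
  rw [real_inner_comm k p]
  linarith

lemma IsGammaZero.hasFDerivAt_conj [FiniteDimensional ℝ H] (hf : IsGammaZero f)
    (hs : StrictConvexOn ℝ (interior (edom f)) fun x => (f x).toReal) {p : H}
    (hp : GateauxDiffAt f p) :
    HasFDerivAt (fun u => (conj f u).toReal) (innerSL ℝ p) (grad f p) := by
  rw [hasFDerivAt_iff_isLittleO_nhds_zero, Asymptotics.isLittleO_iff]
  intro ε hε
  obtain ⟨δ, hδ, hle⟩ := hf.exists_conj_grad_add_le hs hp hε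
  filter_upwards [Metric.closedBall_mem_nhds (0 : H) hδ] with k hk
  have hub := hle k (by simpa using hk)
  have hlb := hf.le_conj (interior_subset (hasGateauxGrad_grad hp).1) (grad f p + k)
  obtain ⟨a, ha⟩ : ∃ a : ℝ, conj f (grad f p + k) = a := by
    refine ⟨(conj f (grad f p + k)).toReal, (EReal.coe_toReal ?_ ?_).symm⟩
    · exact (hub.trans_lt (EReal.coe_lt_top _)).ne
    · exact ((EReal.bot_lt_coe _).trans_le hlb).ne'
  rw [ha, EReal.coe_le_coe_iff] at hub hlb
  rw [ha, hf.conj_grad hp, EReal.toReal_coe, EReal.toReal_coe, innerSL_apply_apply,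
    Real.norm_eq_abs, abs_le]
  rw [inner_add_left, real_inner_comm p k] at hlb
  have : 0 ≤ ε * ‖k‖ := by positivity
  constructor <;> linarith

lemma IsGammaZero.hasGateauxGrad_conj [FiniteDimensional ℝ H] (hf : IsGammaZero f)
    (hs : StrictConvexOn ℝ (interior (edom f)) fun x => (f x).toReal) {p : H}
    (hp : GateauxDiffAt f p) : HasGateauxGrad (conj f) p (grad f p) := by
  refine ⟨?_, fun h => ?_⟩
  · obtain ⟨δ, hδ, hle⟩ := hf.exists_conj_grad_add_le hs hp one_pos
    rw [mem_interior_iff_mem_nhds]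
    filter_upwards [Metric.closedBall_mem_nhds (grad f p) hδ] with u hu
    have := hle (u - grad f p) (by rwa [← dist_eq_norm])
    rw [add_sub_cancel] at this
    exact this.trans_lt (EReal.coe_lt_top _)
  · simpa using (hf.hasFDerivAt_conj hs hp).hasLineDerivAt h

/-- Taking gradients exchanges the two arguments of the Bregman distance. -/
lemma IsGammaZero.bregman_conj_grad [FiniteDimensional ℝ H] (hf : IsGammaZero f)
    (hs : StrictConvexOn ℝ (interior (edom f)) fun x => (f x).toReal) {p z : H}
    (hp : GateauxDiffAt f p) (hz : GateauxDiffAt f z) :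
    bregman (conj f) (grad f p) (grad f z) = bregman f z p := by
  have h := hf.hasGateauxGrad_conj hs hz
  rw [bregman_eq_coe (hf.conj_grad hp) (hf.conj_grad hz) h.1, h.grad_eq,
    hf.bregman_eq (interior_subset (hasGateauxGrad_grad hz).1) (hasGateauxGrad_grad hp).1]
  congr 1
  simp only [realBregman, inner_sub_right, real_inner_comm z]
  ring

/-- The backward projections of `∇f(z)` onto `∇f(M)` with respect to the conjugate are the
gradients of the forward projections of `z` onto `M`. -/
lemma IsGammaZero.mem_backProj_conj_iff [FiniteDimensional ℝ H] (hf : IsGammaZero f)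
    (hs : StrictConvexOn ℝ (interior (edom f)) fun x => (f x).toReal)
    (hdiff : ∀ x ∈ interior (edom f), GateauxDiffAt f x) {M : Set H}
    (hM : M ⊆ interior (edom f)) {z : H} (hz : GateauxDiffAt f z) {v : H} :
    v ∈ backProj (conj f) (grad f '' M) (grad f z) ↔ v ∈ grad f '' forwardProj f M z := by
  constructor
  · rintro ⟨⟨⟨p, hp, rfl⟩, -⟩, hmin⟩
    refine ⟨p, ⟨⟨hp, hM hp⟩, fun c hc => ?_⟩, rfl⟩
    rw [← hf.bregman_conj_grad hs (hdiff p (hM hp)) hz,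
      ← hf.bregman_conj_grad hs (hdiff c (hM hc)) hz]
    exact hmin _ ⟨c, hc, rfl⟩
  · rintro ⟨p, ⟨⟨hp, -⟩, hmin⟩, rfl⟩
    refine ⟨⟨⟨p, hp, rfl⟩,
      interior_subset (hf.hasGateauxGrad_conj hs (hdiff p (hM hp))).1⟩, ?_⟩
    rintro _ ⟨c, hc, rfl⟩
    rw [hf.bregman_conj_grad hs (hdiff p (hM hp)) hz,
      hf.bregman_conj_grad hs (hdiff c (hM hc)) hz]
    exact hmin c hc

/-- If `∇f(M)` is convex, a forward projection `p` of `z` onto `M` satisfies the variational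
inequality on `∇f(M)`: the conjugate is differentiable at `∇f(p)` with gradient `p`. -/
lemma IsGammaZero.inner_nonneg_of_mem_forwardProj [FiniteDimensional ℝ H] (hf : IsGammaZero f)
    (hs : StrictConvexOn ℝ (interior (edom f)) fun x => (f x).toReal)
    (hdiff : ∀ x ∈ interior (edom f), GateauxDiffAt f x) {M : Set H}
    (hM : M ⊆ interior (edom f)) (hconv : Convex ℝ (grad f '' M)) {z p : H} (hz : z ∈ edom f)
    (hp : p ∈ forwardProj f M z) {w : H} (hw : w ∈ grad f '' M) :
    0 ≤ inner ℝ (w - grad f p) (p - z) := by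
  have hpd := hdiff p hp.1.2
  have hlim := ((hf.hasFDerivAt_conj hs hpd).hasLineDerivAt (w - grad f p)).tendsto_slope_zero_right
  have hle : inner ℝ z (w - grad f p) ≤ innerSL ℝ p (w - grad f p) := by
    refine ge_of_tendsto hlim ?_
    filter_upwards [Ioo_mem_nhdsGT (zero_lt_one' ℝ)] with t ht
    obtain ⟨c, hc, hct⟩ := hconv.add_smul_sub_mem ⟨p, hp.1.1, rfl⟩ hw ⟨ht.1.le, ht.2.le⟩
    have hmin := hp.2 c hc
    rw [hf.bregman_eq hz hp.1.2, hf.bregman_eq hz (hM hc), EReal.coe_le_coe_iff] at hmin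
    rw [← hct, hf.conj_grad (hdiff c (hM hc)), hf.conj_grad hpd, EReal.toReal_coe,
      EReal.toReal_coe, smul_eq_mul, le_inv_mul_iff₀ ht.1]
    have e : t * inner ℝ z (w - grad f p) = inner ℝ z (grad f c) - inner ℝ z (grad f p) := by
      rw [hct, inner_add_right, inner_smul_right]
      ring
    simp only [realBregman, inner_sub_right] at hmin
    rw [e, real_inner_comm _ z, real_inner_comm _ z]
    linarith
  rw [innerSL_apply_apply] at hle
  rw [inner_sub_right, real_inner_comm p, real_inner_comm z]
  linarith

/-! ### Affine gradient images -/

/-- If `∇f` maps an affine subspace `M` onto an affine subspace `A`, strict monotonicity makes the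
direction of `M` and the orthogonal complement of the direction of `A` span the space; so from any
`z` one reaches a point of `M` by moving orthogonally to `A`. -/
lemma IsGammaZero.exists_mem_inner_eq_zero [FiniteDimensional ℝ H] (hf : IsGammaZero f)
    (hs : StrictConvexOn ℝ (interior (edom f)) fun x => (f x).toReal)
    (hdiff : ∀ x ∈ interior (edom f), GateauxDiffAt f x) {M A : AffineSubspace ℝ H}
    (hM : (M : Set H) ⊆ interior (edom f)) (hne : (M : Set H).Nonempty)
    (hA : grad f '' (M : Set H) = A) (z : H) :
    ∃ p ∈ M, ∀ w ∈ A.direction, inner ℝ w (p - z) = 0 := by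
  obtain ⟨p₀, hp₀⟩ := hne
  have hg₀ : grad f p₀ ∈ A := by
    rw [← SetLike.mem_coe, ← hA]
    exact ⟨p₀, hp₀, rfl⟩
  have hbot : M.directionᗮ ⊓ A.direction = ⊥ := by
    rw [eq_bot_iff]
    rintro w ⟨hw1, hw2⟩
    have hmem : w +ᵥ grad f p₀ ∈ (A : Set H) := AffineSubspace.vadd_mem_of_mem_direction hw2 hg₀
    rw [← hA] at hmem
    obtain ⟨p₁, hp₁, he⟩ := hmem
    have hw : grad f p₁ - grad f p₀ = w := by rw [he, vadd_eq_add, add_sub_cancel_right]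
    have hd : p₁ - p₀ ∈ M.direction := AffineSubspace.vsub_mem_direction hp₁ hp₀
    have : p₁ = p₀ := hf.eq_of_inner_grad_sub_eq_zero hs (hdiff _ (hM hp₁)) (hdiff _ (hM hp₀)) (by
      rw [hw, real_inner_comm]
      exact hw1 _ hd)
    rw [Submodule.mem_bot, ← hw, this, sub_self]
  have htop : M.direction ⊔ A.directionᗮ = ⊤ := by
    rw [← Submodule.orthogonal_eq_bot_iff, ← Submodule.inf_orthogonal,
      Submodule.orthogonal_orthogonal, hbot]
  obtain ⟨a, ha, b, hb, hab⟩ := Submodule.mem_sup.1 (htop ▸ Submodule.mem_top : z - p₀ ∈ _)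
  refine ⟨a +ᵥ p₀, AffineSubspace.vadd_mem_of_mem_direction ha hp₀, fun w hw => ?_⟩
  have e : (a +ᵥ p₀) - z = -b := by
    rw [vadd_eq_add, ← sub_add_cancel z p₀, ← hab]
    abel
  rw [e, inner_neg_right, hb w hw, neg_zero]

end BregmanCC
end

/-! ### Backward circumcenters as forward projections -/

theorem theorem3p7 {H : Type*} [NormedAddCommGroup H] [InnerProductSpace ℝ H] [CompleteSpace H]
    (f : H → EReal) (hf : BregmanCC.IsGammaZero f)
    (hint : (interior (BregmanCC.edom f)).Nonempty)
    (hdiff : ∀ x ∈ interior (BregmanCC.edom f), BregmanCC.GateauxDiffAt f x)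
    {m : ℕ} (q : Fin (m + 1) → H) (hq : ∀ i, q i ∈ interior (BregmanCC.edom f))
    (z : H) (hz : z ∈ BregmanCC.backEquidist f (Set.range q)) :
    BregmanCC.backCC f (Set.range q) =
      (affineSpan ℝ (Set.range q) : Set H) ∩ BregmanCC.edom f ∩
        (z +ᵥ ((BregmanCC.gradSpan f q)ᗮ : Set H)) ∧
    (FiniteDimensional ℝ H → BregmanCC.IsLegendre f →
      IsOpen (BregmanCC.edom (BregmanCC.conj f)) → BregmanCC.AllowsForwardProj f →
      (affineSpan ℝ (Set.range q) : Set H) ⊆ interior (BregmanCC.edom f) →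
      (z ∈ interior (BregmanCC.edom f) →
        IsClosed (BregmanCC.gradAff f (Set.range q)) →
        Convex ℝ (BregmanCC.gradAff f (Set.range q)) →
        BregmanCC.Compatible f q z →
        ∃ p, BregmanCC.forwardProj f (affineSpan ℝ (Set.range q) : Set H) z = {p} ∧
          p ∈ BregmanCC.backCC f (Set.range q)) ∧
      ((∃ A : AffineSubspace ℝ H, IsClosed (A : Set H) ∧
          BregmanCC.gradAff f (Set.range q) = A) →
        (z ∈ interior (BregmanCC.edom f) → BregmanCC.Compatible f q z) ∧
        ∃ p, BregmanCC.forwardProj f (affineSpan ℝ (Set.range q) : Set H) z = {p} ∧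
          p ∈ BregmanCC.backCC f (Set.range q))) := by
  have hcc : BregmanCC.backCC f (Set.range q) =
      (affineSpan ℝ (Set.range q) : Set H) ∩ BregmanCC.edom f ∩
        (z +ᵥ ((BregmanCC.gradSpan f q)ᗮ : Set H)) := by
    ext x
    rw [Set.mem_inter_iff, Set.mem_inter_iff, Set.mem_vadd_set_iff_neg_vadd_mem, vadd_eq_add,
      neg_add_eq_sub, SetLike.mem_coe (p := (BregmanCC.gradSpan f q)ᗮ), and_assoc]
    exact and_congr_right fun _ => ⟨fun h => ⟨h.1, (hf.mem_backEquidist_iff hq hz h.1).1 h⟩,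
      fun h => (hf.mem_backEquidist_iff hq hz h.1).2 h.2⟩
  refine ⟨hcc, fun _ hleg _ _ hM => ?_⟩
  have hs : StrictConvexOn ℝ (interior (BregmanCC.edom f)) fun x => (f x).toReal :=
    hleg.essentiallyStrictlyConvex.strictConvexOn _
      hleg.essentiallySmooth.domSubdiff_eq.ge hf.convexOn_toReal.1.interior
  have hqM : ∀ i, q i ∈ affineSpan ℝ (Set.range q) := fun i => mem_affineSpan ℝ ⟨i, rfl⟩
  -- the variational inequality at `p`, together with `p - z ∈ Lᗮ`, gives both conclusions
  have hfin : ∀ p ∈ affineSpan ℝ (Set.range q),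
      (∀ c ∈ affineSpan ℝ (Set.range q),
        0 ≤ inner ℝ (BregmanCC.grad f c - BregmanCC.grad f p) (p - z)) →
      (∀ i : Fin m,
        inner ℝ (BregmanCC.grad f (q i.succ) - BregmanCC.grad f (q 0)) (p - z) = 0) →
      BregmanCC.forwardProj f (affineSpan ℝ (Set.range q) : Set H) z = {p} ∧
        p ∈ BregmanCC.backCC f (Set.range q) := fun p hp hvar hperp =>
    ⟨hf.forwardProj_eq_singleton hs hdiff hM hz.1 hp hvar, hp,
      (hf.mem_backEquidist_iff hq hz (interior_subset (hM hp))).2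
        (BregmanCC.mem_orthogonal_gradSpan_iff.2 hperp)⟩
  constructor
  · intro hzi _ hconv hcomp
    rcases m with _ | m
    · -- here `S` and its affine hull are the single point `q 0`, and compatibility is vacuous
      refine ⟨q 0, hfin _ (hqM 0) (fun c hc => ?_) fun i => i.elim0⟩
      have hr : Set.range q = {q 0} := Set.range_unique (ι := Fin 1)
      rw [hr, AffineSubspace.mem_affineSpan_singleton] at hc
      rw [hc, sub_self, inner_zero_left]
    · have hback : ∀ v, v ∈ BregmanCC.backProj (BregmanCC.conj f)
          (BregmanCC.gradAff f (Set.range q)) (BregmanCC.grad f z) ↔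
          v ∈ BregmanCC.grad f '' BregmanCC.forwardProj f
            (affineSpan ℝ (Set.range q) : Set H) z := fun v =>
        hf.mem_backProj_conj_iff hs hdiff hM (hdiff z hzi)
      -- for at least two points `qᵢ`, compatibility already contains the existence of a projection
      obtain ⟨_, _, v, hv, _⟩ := (hcomp 0).1
      obtain ⟨p, hp, -⟩ := (hback v).1 hv
      have hvar : ∀ w ∈ BregmanCC.gradAff f (Set.range q),
          0 ≤ inner ℝ (w - BregmanCC.grad f p) (p - z) := fun w hw =>
        hf.inner_nonneg_of_mem_forwardProj hs hdiff hM hconv hz.1 hp hw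
      have hsing := hf.forwardProj_eq_singleton hs hdiff hM hz.1 hp.1.1
        fun c hc => hvar _ ⟨c, hc, rfl⟩
      have hnonneg : ∀ g ∈ BregmanCC.gradAff f (Set.range q) -
          BregmanCC.backProj (BregmanCC.conj f) (BregmanCC.gradAff f (Set.range q))
            (BregmanCC.grad f z), 0 ≤ inner ℝ g (p - z) := by
        rintro _ ⟨w, hw, v, hv, rfl⟩
        obtain ⟨p', hp', rfl⟩ := (hback v).1 hv
        rw [hsing, Set.mem_singleton_iff] at hp'
        subst hp'
        exact hvar w hw
      refine ⟨p, hfin p hp.1.1 (fun c hc => hvar _ ⟨c, hc, rfl⟩) fun i => ?_⟩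
      have h1 := hnonneg _ (hcomp i).1
      have h2 := hnonneg _ (hcomp i).2
      rw [inner_neg_left] at h2
      linarith
  · rintro ⟨A, -, hA⟩
    obtain ⟨p, hp, hperp⟩ := hf.exists_mem_inner_eq_zero hs hdiff hM ⟨q 0, hqM 0⟩ hA z
    have hgA : ∀ c ∈ affineSpan ℝ (Set.range q), BregmanCC.grad f c ∈ A := by
      intro c hc
      rw [← SetLike.mem_coe, ← hA]
      exact ⟨c, hc, rfl⟩
    have hdir : ∀ c ∈ affineSpan ℝ (Set.range q), ∀ d ∈ affineSpan ℝ (Set.range q),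
        BregmanCC.grad f c - BregmanCC.grad f d ∈ A.direction := fun c hc d hd =>
      AffineSubspace.vsub_mem_direction (hgA c hc) (hgA d hd)
    have hpfin := hfin p hp (fun c hc => (hperp _ (hdir c hc p hp)).ge)
      fun i => hperp _ (hdir _ (hqM _) _ (hqM _))
    refine ⟨fun hzi => ?_, p, hpfin⟩
    have hmem : ∀ g ∈ A.direction, g ∈ BregmanCC.gradAff f (Set.range q) -
        BregmanCC.backProj (BregmanCC.conj f) (BregmanCC.gradAff f (Set.range q))
          (BregmanCC.grad f z) := by
      intro g hg
      refine ⟨g +ᵥ BregmanCC.grad f p, ?_, BregmanCC.grad f p, ?_, by simp⟩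
      · rw [hA]
        exact AffineSubspace.vadd_mem_of_mem_direction hg (hgA p hp)
      · refine (hf.mem_backProj_conj_iff hs hdiff hM (hdiff z hzi)).2 ⟨p, ?_, rfl⟩
        rw [hpfin.1]
        rfl
    exact fun i => ⟨hmem _ (hdir _ (hqM _) _ (hqM _)),
      hmem _ (neg_mem (hdir _ (hqM _) _ (hqM _)))⟩
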